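/- Let $G$ be a non-trivial finite or countably infinite group, and let $H$ be a finite group with $|H|\ge 3$. Let $X=\bigsqcup_{j\in\mathbf N}G_j$ be the disjoint union of countably infinitely many copies $G_j=G$ of $G$, on which $G$ acts by left multiplication on each copy (or any $G$-set isomorphic to it). Equip $\operatorname{Sym}(X)$ with the topology of pointwise convergence of permutations and of their inverses ($X$ being discrete), and the set $\operatorname{Hom}(H,\operatorname{Sym}(X))$ of $H$-actions on $X$ with the topology induced from the product topology on $\operatorname{Sym}(X)^H$. For $\sigma\in\operatorname{Hom}(H,\operatorname{Sym}(X))$ let $\langle G,\sigma(H)\rangle$ be the subgroup of $\operatorname{Sym}(X)$ generated by $\sigma(H)$ and the image of $G$. Let $\mathcal A$ be the set, with the subspace topology, of the $\sigma$ that are admissible, i.e. such that all $\langle G,\sigma(H)\rangle$-orbits in $X$ are infinite. Then $\mathcal A$ is a Baire space, and the set of all $\sigma\in\mathcal A$ such that - $\langle G,\sigma(H)\rangle$ acts highly transitively on $X$ (for every integer $k\ge 1$ it acts transitively on the ordered $k$-tuples of distinct elements of $X$), and - the action of the free product $G*H$ on $X$ induced by $\sigma$ and the action of $G$ is faithful is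 generic in $\mathcal A$, i.e. it is a countable intersection of dense open subsets of $\mathcal A$. -/

import Mathlib

namespace FreeProductAction

/-- The topology on `Sym(X)` of pointwise convergence of permutations and of their inverses, `X`
being discrete: the coarsest topology for which all the maps `σ ↦ σ x` and `σ ↦ σ⁻¹ x` are
continuous. For countable `X` it is the topology of the metric
`d(σ, τ) = 2 ^ (-inf {k | σ x_k ≠ τ x_k or σ⁻¹ x_k ≠ τ⁻¹ x_k})`, for any enumeration `(x_k)`. -/
abbrev permTopology (X : Type*) : TopologicalSpace (Equiv.Perm X) :=
  TopologicalSpace.induced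
    (fun σ : Equiv.Perm X => ((σ : X → X), ((σ⁻¹ : Equiv.Perm X) : X → X)))
    (@instTopologicalSpaceProd (X → X) (X → X)
      (@Pi.topologicalSpace X (fun _ => X) (fun _ => ⊥))
      (@Pi.topologicalSpace X (fun _ => X) (fun _ => ⊥)))

section

variable (G : Type*) {H X : Type*} [Group G] [Group H] [MulAction G X]

/-- The subgroup `⟨G, σ(H)⟩` of `Sym(X)` generated by the image of `G` and the image of `σ`. -/
def jointGroup (σ : H →* Equiv.Perm X) : Subgroup (Equiv.Perm X) :=
  (MulAction.toPermHom G X).range ⊔ σ.range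

/-- The action `σ` of `H` is admissible if all orbits of `⟨G, σ(H)⟩` in `X` are infinite. -/
def IsAdmissible (σ : H →* Equiv.Perm X) : Prop :=
  ∀ x : X, (MulAction.orbit (jointGroup G σ) x).Infinite

/-- `⟨G, σ(H)⟩` acts highly transitively on the (infinite) set `X`: for every positive `k` it is
transitive on ordered `k`-tuples of distinct elements. -/
def IsHighlyTransitive (σ : H →* Equiv.Perm X) : Prop :=
  ∀ k : ℕ, 0 < k → MulAction.IsMultiplyPretransitive (jointGroup G σ) X k

/-- The action of the free product `G * H` on `X` induced by the action of `G` and by `σ` is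
faithful. -/
def IsFaithful (σ : H →* Equiv.Perm X) : Prop :=
  Function.Injective (Monoid.Coprod.lift (MulAction.toPermHom G X) σ)

end

/-- The set of admissible actions of `H` on the `G`-set `X`. -/
def AdmissibleAction (G H X : Type*) [Group G] [Group H] [MulAction G X] : Type _ :=
  {σ : H →* Equiv.Perm X // IsAdmissible G σ}

/-- The topology induced from the product topology on `Sym(X)^H` (used for finite `H`). -/
instance AdmissibleAction.instTopologicalSpace (G H X : Type*) [Group G] [Group H] [MulAction G X] :
    TopologicalSpace (AdmissibleAction G H X) :=
  TopologicalSpace.induced (fun σ (h : H) => σ.1 h)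
    (@Pi.topologicalSpace H (fun _ => Equiv.Perm X) (fun _ => permTopology X))

/-- A subset is generic if it is a countable intersection of dense open subsets. -/
def IsGeneric {Z : Type*} [TopologicalSpace Z] (S : Set Z) : Prop :=
  ∃ U : ℕ → Set Z, (∀ n, IsOpen (U n) ∧ Dense (U n)) ∧ S = ⋂ n, U n

end FreeProductAction

/-! The admissible actions form a `Gδ` in the space of all actions, which is completely metrizable,
so Baire holds. High transitivity and faithfulness are countable families of open conditions: some
word maps a given tuple `x` to a given tuple `y`; a given word `w ≠ 1` moves some point. What
remains is density: given an admissible `σ` and a finite `σ(H)`-invariant set `F`, find an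
admissible `τ` that equals `σ` on `F` and satisfies one given condition.

For `w ≠ 1` (`exists_admissible_agree_apply_ne`), let `G * H` act diagonally on `T × X`, where `T`
is the regular `G * H`-set plus a fixed point. As a `G`-set this is again `X`, by an isomorphism
that can be the identity on the copy of `F` over the fixed point. Projection to `X` keeps orbits
infinite, and `w` moves the regular coordinate.

For disjoint tuples (`exists_admissible_agree_map_tuple`), keep `σ` on `F` and hang trees outside
it: each root starts a free `H`-orbit whose other points are base points of fresh `G`-orbits, and
the remaining points of these orbits are roots again. Since `|H| ≥ 3`, reduced words lead out of
`F`, so one word `v` carries all `x i` and `y i` to far roots. Redefine `b ∈ H` there to send `v (x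
i)` to `v (y i)`; then `v⁻¹ b v` maps `x` to `y`. A branch labelled by `a ≠ b` avoids these links
and keeps orbits infinite. -/

namespace FreeProductAction

/-! ### Orbits, transitivity and faithfulness in terms of words -/

section Orbits

variable {G H X : Type*} [Group G] [Group H] [MulAction G X]

/-- The action on `X` of the free product induced by the action of `G` and by `σ`. -/
def freeProductHom (G : Type*) {H X : Type*} [Group G] [Group H] [MulAction G X]
    (σ : H →* Equiv.Perm X) : Monoid.Coprod G H →* Equiv.Perm X :=
  Monoid.Coprod.lift (MulAction.toPermHom G X) σ

@[simp] theorem freeProductHom_inl (σ : H →* Equiv.Perm X) (g : G) (x : X) :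
    freeProductHom G σ (.inl g) x = g • x := by
  simp [freeProductHom]

@[simp] theorem freeProductHom_inr (σ : H →* Equiv.Perm X) (h : H) (x : X) :
    freeProductHom G σ (.inr h) x = σ h x := by
  simp [freeProductHom]

theorem range_freeProductHom (σ : H →* Equiv.Perm X) :
    (freeProductHom G σ).range = jointGroup G σ :=
  Monoid.Coprod.range_lift _ _

theorem mem_orbit_jointGroup_iff {σ : H →* Equiv.Perm X} {x y : X} :
    y ∈ MulAction.orbit (jointGroup G σ) x ↔
      ∃ w : Monoid.Coprod G H, freeProductHom G σ w x = y := by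
  rw [← range_freeProductHom]
  constructor
  · rintro ⟨⟨_, w, rfl⟩, rfl⟩
    exact ⟨w, rfl⟩
  · rintro ⟨w, rfl⟩
    exact ⟨⟨_, w, rfl⟩, rfl⟩

/-- A set stable under `G` and `H` is stable under the free product. -/
theorem freeProductHom_mem {σ : H →* Equiv.Perm X} {S : Set X}
    (hG : ∀ (g : G), ∀ x ∈ S, g • x ∈ S) (hH : ∀ (h : H), ∀ x ∈ S, σ h x ∈ S)
    (w : Monoid.Coprod G H) : ∀ x ∈ S, freeProductHom G σ w x ∈ S := by
  induction w using Monoid.Coprod.induction_on with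
  | inl g => simpa using hG g
  | inr h => simpa using hH h
  | mul a b ha hb =>
    intro x hx
    rw [map_mul]
    exact ha _ (hb _ hx)

theorem orbit_jointGroup_subset {σ : H →* Equiv.Perm X} {S : Set X}
    (hG : ∀ (g : G), ∀ x ∈ S, g • x ∈ S) (hH : ∀ (h : H), ∀ x ∈ S, σ h x ∈ S)
    {x : X} (hx : x ∈ S) : MulAction.orbit (jointGroup G σ) x ⊆ S := by
  intro y hy
  obtain ⟨w, rfl⟩ := mem_orbit_jointGroup_iff.1 hy
  exact freeProductHom_mem hG hH w x hx

theorem smul_mem_orbit_jointGroup {σ : H →* Equiv.Perm X} (g : G) {x y : X}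
    (hy : y ∈ MulAction.orbit (jointGroup G σ) x) :
    g • y ∈ MulAction.orbit (jointGroup G σ) x := by
  rw [mem_orbit_jointGroup_iff] at hy ⊢
  obtain ⟨w, rfl⟩ := hy
  exact ⟨.inl g * w, by simp [map_mul]⟩

theorem apply_mem_orbit_jointGroup {σ : H →* Equiv.Perm X} (h : H) {x y : X}
    (hy : y ∈ MulAction.orbit (jointGroup G σ) x) :
    σ h y ∈ MulAction.orbit (jointGroup G σ) x := by
  rw [mem_orbit_jointGroup_iff] at hy ⊢
  obtain ⟨w, rfl⟩ := hy
  exact ⟨.inr h * w, by simp [map_mul]⟩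

theorem isHighlyTransitive_iff {σ : H →* Equiv.Perm X} :
    IsHighlyTransitive G σ ↔ ∀ (k : ℕ) (x y : Fin k ↪ X),
      ∃ w : Monoid.Coprod G H, ∀ i, freeProductHom G σ w (x i) = y i := by
  constructor
  · intro hσ k x y
    rcases Nat.eq_zero_or_pos k with rfl | hk
    · exact ⟨1, fun i => i.elim0⟩
    · obtain ⟨⟨f, hf⟩, hg⟩ := (hσ k hk).exists_smul_eq x y
      rw [← range_freeProductHom] at hf
      obtain ⟨w, rfl⟩ := hf
      exact ⟨w, fun i => DFunLike.congr_fun hg i⟩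
  · intro hσ k _
    refine ⟨fun x y => ?_⟩
    obtain ⟨w, hw⟩ := hσ k x y
    exact ⟨⟨freeProductHom G σ w, by rw [← range_freeProductHom]; exact ⟨w, rfl⟩⟩,
      DFunLike.ext _ _ hw⟩

theorem isFaithful_iff {σ : H →* Equiv.Perm X} :
    IsFaithful G σ ↔ ∀ w : Monoid.Coprod G H, w ≠ 1 → ∃ x, freeProductHom G σ w x ≠ x := by
  change Function.Injective (freeProductHom G σ) ↔ _
  rw [injective_iff_map_eq_one]
  refine forall_congr' fun w => ?_
  rw [← not_imp_not, Equiv.ext_iff, not_forall]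
  rfl

end Orbits

/-! ### Topology of the space of actions, Baire property, density criterion -/

section Topology

variable {G H X : Type*} [Group G] [Group H] [MulAction G X]

/-- The topology of pointwise convergence on the set of actions of `H` on `X`. -/
abbrev homTopology (H X : Type*) [Group H] [TopologicalSpace X] :
    TopologicalSpace (H →* Equiv.Perm X) :=
  TopologicalSpace.induced (fun σ (h : H) (x : X) => σ h x) inferInstance

attribute [local instance] homTopology

theorem continuous_hom_apply [TopologicalSpace X] (h : H) (x : X) :
    Continuous fun σ : H →* Equiv.Perm X => σ h x :=
  (continuous_apply_apply (ρ := fun _ _ => X) h x).comp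
    (continuous_induced_dom (f := fun (σ : H →* Equiv.Perm X) (h : H) (x : X) => σ h x))

/-- For a product, split according to the intermediate point, which is locally constant in `σ`. -/
theorem continuous_freeProductHom [TopologicalSpace X] [DiscreteTopology X]
    (w : Monoid.Coprod G H) :
    ∀ x : X, Continuous fun σ : H →* Equiv.Perm X => freeProductHom G σ w x := by
  induction w using Monoid.Coprod.induction_on with
  | inl g => intro x; simpa using continuous_const
  | inr h => intro x; simpa using continuous_hom_apply h x
  | mul a b ha hb =>
    intro x
    rw [continuous_discrete_rng]
    intro c
    have : (fun σ : H →* Equiv.Perm X => freeProductHom G σ (a * b) x) ⁻¹' {c} =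
        ⋃ y, ((fun σ => freeProductHom G σ b x) ⁻¹' {y} ∩
          (fun σ => freeProductHom G σ a y) ⁻¹' {c}) := by
      ext σ
      simp [map_mul]
    rw [this]
    exact isOpen_iUnion fun y =>
      (continuous_discrete_rng.1 (hb x) y).inter (continuous_discrete_rng.1 (ha y) c)

theorem isOpen_freeProductHom_apply_eq [TopologicalSpace X] [DiscreteTopology X]
    (w : Monoid.Coprod G H) (x y : X) :
    IsOpen {σ : H →* Equiv.Perm X | freeProductHom G σ w x = y} :=
  continuous_discrete_rng.1 (continuous_freeProductHom w x) y

/-- The image is cut out by the action axioms, which are closed pointwise conditions; bijectivity is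
automatic because `H` is a group. -/
theorem isClosedEmbedding_coe_hom [TopologicalSpace X] [DiscreteTopology X] :
    Topology.IsClosedEmbedding (fun (σ : H →* Equiv.Perm X) (h : H) (x : X) => σ h x) := by
  refine ⟨⟨⟨rfl⟩, fun σ τ hst => ?_⟩, ?_⟩
  · ext h x
    exact congr_fun (congr_fun hst h) x
  · have : Set.range (fun (σ : H →* Equiv.Perm X) (h : H) (x : X) => σ h x) =
        (⋂ x : X, {f : H → X → X | f 1 x = x}) ∩
          ⋂ (h : H) (k : H) (x : X), ⋃ y : X, ({f | f k x = y} ∩ {f | f (h * k) x = f h y}) := by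
      ext f
      simp only [Set.mem_range, Set.mem_inter_iff, Set.mem_iInter, Set.mem_iUnion,
        Set.mem_ofPred_eq]
      constructor
      · rintro ⟨σ, rfl⟩
        simp
      · rintro ⟨h1, h2⟩
        have h3 : ∀ h k x, f (h * k) x = f h (f k x) := by
          intro h k x
          obtain ⟨y, hy, hy'⟩ := h2 h k x
          rw [hy', hy]
        let _ : MulAction H X :=
          { smul := fun h x => f h x
            one_smul := h1
            mul_smul := h3 }
        exact ⟨MulAction.toPermHom H X, rfl⟩
    rw [this]
    refine (isClosed_iInter fun x => ?_).inter
      (isClosed_iInter fun h => isClosed_iInter fun k => isClosed_iInter fun x => ?_)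
    · exact isClosed_eq (by fun_prop) (by fun_prop)
    -- As `f k x` has exactly one value, "for some `y`" equals "for all `y`", and the latter form is
    -- visibly closed.
    · have : (⋃ y : X, ({f : H → X → X | f k x = y} ∩ {f | f (h * k) x = f h y})) =
          ⋂ y : X, ({f : H → X → X | f k x = y}ᶜ ∪ {f | f (h * k) x = f h y}) := by
        ext f
        simp [← imp_iff_not_or]
      rw [this]
      refine isClosed_iInter fun y => IsClosed.union ?_ ?_
      · rw [isClosed_compl_iff]
        exact (isOpen_discrete {y}).preimage (by fun_prop : Continuous fun f : H → X → X => f k x)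
      · exact isClosed_eq (by fun_prop) (by fun_prop)

/-- For fixed `x` and `n`, having at least `n` points in the orbit of `x` is an open condition,
witnessed by finitely many words. -/
theorem isGδ_setOf_isAdmissible [Countable X] [TopologicalSpace X] [DiscreteTopology X] :
    IsGδ {σ : H →* Equiv.Perm X | IsAdmissible G σ} := by
  have : {σ : H →* Equiv.Perm X | IsAdmissible G σ} =
      ⋂ (x : X) (n : ℕ), ⋃ s ∈ {s : Finset X | n ≤ s.card},
        ⋂ y ∈ s, ⋃ w : Monoid.Coprod G H, {σ | freeProductHom G σ w x = y} := by
    ext σ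
    simp only [Set.mem_ofPred_eq, Set.mem_iInter, Set.mem_iUnion, exists_prop, IsAdmissible]
    refine forall_congr' fun x => ?_
    constructor
    · intro h n
      obtain ⟨s, hs, rfl⟩ := h.exists_subset_card_eq n
      exact ⟨s, le_rfl, fun y hy => mem_orbit_jointGroup_iff.1 (hs hy)⟩
    · intro h hfin
      obtain ⟨s, hs, hs'⟩ := h (hfin.toFinset.card + 1)
      have : s ⊆ hfin.toFinset := fun y hy => by
        simpa using mem_orbit_jointGroup_iff.2 (hs' y hy)
      have := Finset.card_le_card this
      omega
  rw [this]
  refine .iInter fun x => .iInter fun n => IsOpen.isGδ ?_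
  exact isOpen_biUnion fun s _ => isOpen_biInter_finset fun y _ =>
    isOpen_iUnion fun w => isOpen_freeProductHom_apply_eq w x y

/-- A `Gδ` subset of a completely metrizable space is a Baire space. -/
theorem baireSpace_of_isGδ {Y : Type*} [TopologicalSpace Y]
    [TopologicalSpace.IsCompletelyMetrizableSpace Y] {s : Set Y} (hs : IsGδ s) :
    BaireSpace s := by
  have : TopologicalSpace.IsCompletelyMetrizableSpace (closure s) :=
    isClosed_closure.isClosedEmbedding_subtypeVal.IsCompletelyMetrizableSpace
  have : BaireSpace ((↑) ⁻¹' s : Set (closure s)) :=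
    (hs.preimage continuous_subtype_val).baireSpace_of_dense
      (by simp [Subtype.dense_iff, Set.inter_eq_right.mpr subset_closure])
  have h_homeo : Homeomorph ((↑) ⁻¹' s : Set (closure s)) s := ⟨⟨fun x => ⟨x, x.2⟩,
    fun x => ⟨⟨x, subset_closure x.2⟩, x.2⟩, by grind, by grind⟩, by fun_prop, by fun_prop⟩
  exact h_homeo.baireSpace

/-- Convergence of inverses comes for free, since `(σ h)⁻¹ = σ h⁻¹`. -/
theorem AdmissibleAction.isInducing_val [t : TopologicalSpace X] [DiscreteTopology X] :
    Topology.IsInducing (fun σ : AdmissibleAction G H X => σ.1) := by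
  have ht : permTopology X = TopologicalSpace.induced
      (fun σ : Equiv.Perm X => ((σ : X → X), ((σ⁻¹ : Equiv.Perm X) : X → X))) inferInstance := by
    rw [permTopology, ← DiscreteTopology.eq_bot (α := X)]
  let _ := permTopology X
  have hind : Topology.IsInducing
      (fun σ : Equiv.Perm X => ((σ : X → X), ((σ⁻¹ : Equiv.Perm X) : X → X))) := ⟨ht⟩
  have hA : Topology.IsInducing (fun (σ : AdmissibleAction G H X) (h : H) => σ.1 h) := ⟨rfl⟩
  refine ⟨le_antisymm ?_ ?_⟩
  · rw [← continuous_iff_le_induced, continuous_induced_rng]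
    refine continuous_pi fun h => continuous_pi fun x => ?_
    exact ((continuous_apply x).comp (continuous_fst.comp hind.continuous)).comp
      ((continuous_apply h).comp hA.continuous)
  · have h1 : ∀ (h : H) (x : X), @Continuous _ _ (TopologicalSpace.induced
        (fun σ : AdmissibleAction G H X => σ.1) (homTopology H X)) t
        fun σ : AdmissibleAction G H X => σ.1 h x :=
      fun h x =>
        @Continuous.comp _ _ _ (_) _ _ _ _ (continuous_hom_apply h x) continuous_induced_dom
    rw [hA.eq_induced, ← continuous_iff_le_induced]
    let _ := TopologicalSpace.induced
      (fun σ : AdmissibleAction G H X => σ.1) (homTopology H X)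
    refine @continuous_pi _ _ _ _ _ _ fun h => hind.continuous_iff.2 ?_
    refine @Continuous.prodMk _ _ _ _ _ (_) _ _
      (@continuous_pi _ _ _ (_) _ _ fun x => h1 h x) (@continuous_pi _ _ _ (_) _ _ fun x => ?_)
    simpa using h1 h⁻¹ x

theorem AdmissibleAction.baireSpace [Countable H] [Countable X] :
    BaireSpace (AdmissibleAction G H X) := by
  let _ : TopologicalSpace X := ⊥
  have : DiscreteTopology X := ⟨rfl⟩
  have : TopologicalSpace.IsCompletelyMetrizableSpace (H →* Equiv.Perm X) :=
    isClosedEmbedding_coe_hom.IsCompletelyMetrizableSpace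
  have h := baireSpace_of_isGδ (isGδ_setOf_isAdmissible (G := G) (H := H) (X := X))
  rw [AdmissibleAction.isInducing_val.eq_induced]
  exact h

theorem AdmissibleAction.isOpen_freeProductHom_apply_eq (w : Monoid.Coprod G H) (x y : X) :
    IsOpen {σ : AdmissibleAction G H X | freeProductHom G σ.1 w x = y} := by
  let _ : TopologicalSpace X := ⊥
  have : DiscreteTopology X := ⟨rfl⟩
  exact (FreeProductAction.isOpen_freeProductHom_apply_eq w x y).preimage
    AdmissibleAction.isInducing_val.continuous

/-- A set of admissible actions is dense if every admissible action agrees with one of its members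
on any given finite invariant set. -/
theorem AdmissibleAction.dense_of_forall_agree [Finite H] {U : Set (AdmissibleAction G H X)}
    (hU : ∀ σ : AdmissibleAction G H X, ∀ F : Set X, F.Finite → (∀ h, ∀ x ∈ F, σ.1 h x ∈ F) →
      ∃ τ ∈ U, ∀ h, ∀ x ∈ F, τ.1 h x = σ.1 h x) : Dense U := by
  let _ : TopologicalSpace X := ⊥
  have : DiscreteTopology X := ⟨rfl⟩
  have hind : Topology.IsInducing (fun (σ : AdmissibleAction G H X) (h : H) (x : X) => σ.1 h x) :=
    isClosedEmbedding_coe_hom.isInducing.comp AdmissibleAction.isInducing_val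
  refine hind.dense_iff.2 fun σ => mem_closure_iff.2 fun O hO hσ => ?_
  obtain ⟨u, hu, huO⟩ := isOpen_pi_iff'.1 hO _ hσ
  choose I v hv hvu using fun h => isOpen_pi_iff.1 (hu h).1 _ (hu h).2
  -- The points tested by a basic open set, saturated under `σ(H)`; still finite because `H` is.
  let F : Set X := ⋃ (h : H) (k : H), σ.1 h '' (I k : Set X)
  have hF : F.Finite :=
    Set.finite_iUnion fun h => Set.finite_iUnion fun k => (I k).finite_toSet.image _
  obtain ⟨τ, hτU, hτ⟩ := hU σ F hF fun h x hx => by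
    simp only [F, Set.mem_iUnion] at hx ⊢
    obtain ⟨k, l, y, hy, rfl⟩ := hx
    exact ⟨h * k, l, y, hy, by simp [map_mul]⟩
  refine ⟨_, huO fun h _ => hvu h fun x hx => ?_, τ, hτU, rfl⟩
  have hxF : x ∈ F := by
    simp only [F, Set.mem_iUnion]
    exact ⟨1, h, x, hx, by simp⟩
  simpa only [hτ h x hxF] using (hv h x hx).2

end Topology

/-! ### Density for faithfulness: products with a regular action -/

section Cover

variable {G H X : Type*} [Group G] [Group H] [MulAction G X]

theorem countable_coprod [Countable G] [Countable H] : Countable (Monoid.Coprod G H) :=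
  have : Countable (FreeMonoid (G ⊕ H)) := inferInstanceAs (Countable (List (G ⊕ H)))
  Monoid.Coprod.mk_surjective.countable

/-- A partial injection from a copy of `ℕ` in a countable set to `ℕ` extends to a bijection. -/
theorem exists_equiv_nat_apply_eq {T : Type*} [Countable T] (t₀ : T) [Nontrivial T]
    {I : Set ℕ} (hI : I.Finite) :
    ∃ θ : T × ℕ ≃ ℕ, ∀ n ∈ I, θ (t₀, n) = n := by
  let s : Set (T × ℕ) := (fun n => (t₀, n)) '' I
  have hs : s.Finite := hI.image _
  let f : s ↪ ℕ := ⟨fun p => p.1.2, by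
    rintro ⟨_, n, hn, rfl⟩ ⟨_, m, hm, rfl⟩ h
    obtain rfl : n = m := h
    rfl⟩
  have : Infinite (T × ℕ) := Prod.infinite_of_right
  have h1 : Infinite (sᶜ : Set (T × ℕ)) := hs.infinite_compl.to_subtype
  have : Finite s := hs
  have h2 : Infinite ((Set.range f)ᶜ : Set ℕ) := (Set.finite_range f).infinite_compl.to_subtype
  obtain ⟨θ, hθ⟩ := Cardinal.extend_function f
    ⟨(nonempty_denumerable _).some.eqv.trans (nonempty_denumerable _).some.eqv.symm⟩
  exact ⟨θ, fun n hn => hθ ⟨(t₀, n), n, hn, rfl⟩⟩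

/-- Free `G`-sets with countably many orbits absorb products with countable sets. -/
theorem exists_equiv_prod_smul {T : Type*} [Countable T] [Nontrivial T] [MulAction G T] (t₀ : T)
    (ht₀ : ∀ g : G, g • t₀ = t₀)
    (e : X ≃ (_ : ℕ) × G) (he : ∀ (g : G) (x : X), e (g • x) = ⟨(e x).1, g * (e x).2⟩)
    {F : Set X} (hF : F.Finite) :
    ∃ φ : T × X ≃ X, (∀ (g : G) (t : T) (x : X), φ (g • t, g • x) = g • φ (t, x)) ∧
      ∀ x ∈ F, φ (t₀, x) = x := by
  obtain ⟨θ, hθ⟩ := exists_equiv_nat_apply_eq t₀ (hF.image fun x => (e x).1)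
  -- The map `(t, g) ↦ (g⁻¹ • t, g)` untwists the diagonal action on `T × G`, so `T` only multiplies
  -- the number of orbits; `θ` renumbers them.
  let φ : T × X ≃ X :=
    { toFun := fun p => e.symm ⟨θ ((e p.2).2⁻¹ • p.1, (e p.2).1), (e p.2).2⟩
      invFun := fun x => ((e x).2 • (θ.symm (e x).1).1, e.symm ⟨(θ.symm (e x).1).2, (e x).2⟩)
      left_inv := fun p => by simp
      right_inv := fun x => by simp }
  refine ⟨φ, fun g t x => e.injective ?_, fun x hx => e.injective ?_⟩
  · simp [φ, he, mul_smul]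
  · have : θ (t₀, (e x).1) = (e x).1 := hθ _ ⟨x, hx, rfl⟩
    simp [φ, ht₀, this]

theorem exists_admissible_agree_apply_ne [Countable G] [Countable H]
    (e : X ≃ (_ : ℕ) × G) (he : ∀ (g : G) (x : X), e (g • x) = ⟨(e x).1, g * (e x).2⟩)
    {σ : H →* Equiv.Perm X} (hσ : IsAdmissible G σ) {F : Set X} (hF : F.Finite)
    (hFσ : ∀ h, ∀ x ∈ F, σ h x ∈ F) {w : Monoid.Coprod G H} (hw : w ≠ 1) :
    ∃ τ : H →* Equiv.Perm X, IsAdmissible G τ ∧ (∀ h, ∀ x ∈ F, τ h x = σ h x) ∧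
      ∃ x, freeProductHom G τ w x ≠ x := by
  have := countable_coprod (G := G) (H := H)
  -- `none` is the fixed point, over which `σ` is kept on `F`; the other points form the regular
  -- action.
  let T := Option (Monoid.Coprod G H)
  let _ : MulAction G T := MulAction.compHom T (Monoid.Coprod.inl (M := G) (N := H))
  have hsmul : ∀ (g : G) (t : T), g • t = (Monoid.Coprod.inl g : Monoid.Coprod G H) • t :=
    fun _ _ => rfl
  obtain ⟨φ, hφ, hφF⟩ := exists_equiv_prod_smul (none : T) (fun g => rfl) e he hF
  let ρ : Monoid.Coprod G H →* Equiv.Perm X :=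
    { toFun := fun v =>
        φ.symm.trans (((MulAction.toPerm v : Equiv.Perm T).prodCongr
          (freeProductHom G σ v)).trans φ)
      map_one' := by ext; simp [Prod.map]
      map_mul' := fun a b => by ext; simp [Prod.map, mul_smul] }
  have hρ : ∀ v t x, ρ v (φ (t, x)) = φ (v • t, freeProductHom G σ v x) := fun v t x => by
    simp [ρ]
  let τ : H →* Equiv.Perm X := ρ.comp Monoid.Coprod.inr
  have hτ : freeProductHom G τ = ρ := by
    refine Monoid.Coprod.hom_ext ?_ ?_
    · ext g x
      obtain ⟨⟨t, x⟩, rfl⟩ := φ.surjective x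
      simp [hρ, ← hφ, ← hsmul]
    · ext h x
      simp [τ]
  refine ⟨τ, fun y => ?_, fun h x hx => ?_, φ (some 1, e.symm ⟨0, 1⟩), ?_⟩
  -- The projection to `X` maps a `τ`-orbit onto a set containing a `σ`-orbit.
  · refine Set.Infinite.of_image (fun y => (φ.symm y).2) ((hσ (φ.symm y).2).mono ?_)
    intro z hz
    obtain ⟨v, rfl⟩ := mem_orbit_jointGroup_iff.1 hz
    obtain ⟨⟨t, x⟩, rfl⟩ := φ.surjective y
    refine ⟨ρ v (φ (t, x)), mem_orbit_jointGroup_iff.2 ⟨v, by rw [hτ]⟩, by simp [hρ]⟩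
  · have := hρ (Monoid.Coprod.inr h) none x
    rw [hφF x hx] at this
    simp only [τ, MonoidHom.comp_apply, this, freeProductHom_inr]
    exact hφF _ (hFσ h x hx)
  · rw [hτ, hρ]
    intro h
    have := congr_arg Prod.fst (φ.injective h)
    simp [hw] at this

end Cover

/-! ### Extending actions; reduced words escape finite sets -/

section Tree

variable {G H X : Type*} [Group G] [Group H] [MulAction G X]

/-- An action of `H` on an invariant set `F` extends to an action on `X` which is by left
multiplication on disjoint copies of `H` outside `F`. -/
theorem exists_extension (σ : H →* Equiv.Perm X) {F : Set X} (hF : ∀ h, ∀ x ∈ F, σ h x ∈ F)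
    {R : Set X} {E : X → H → X}
    (hE : ∀ r ∈ R, ∀ s ∈ R, ∀ h k, E r h = E s k → r = s ∧ h = k)
    (hEF : ∀ r ∈ R, ∀ h, E r h ∉ F) :
    ∃ τ : H →* Equiv.Perm X, (∀ h, ∀ x ∈ F, τ h x = σ h x) ∧
      ∀ r ∈ R, ∀ h k, τ h (E r k) = E r (h * k) := by
  classical
  let P : X → Prop := fun x => ∃ p : X × H, p.1 ∈ R ∧ E p.1 p.2 = x
  let f : H → X → X := fun h x =>
    if x ∈ F then σ h x else if hx : P x then E hx.choose.1 (h * hx.choose.2) else x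
  have f1 : ∀ h, ∀ x ∈ F, f h x = σ h x := fun h x hx => if_pos hx
  have f2 : ∀ r ∈ R, ∀ h k, f h (E r k) = E r (h * k) := fun r hr h k => by
    have hP : P (E r k) := ⟨(r, k), hr, rfl⟩
    have hc := hP.choose_spec
    obtain ⟨h1, h2⟩ := hE _ hc.1 _ hr _ _ hc.2
    simp only [f, if_neg (hEF r hr k), dif_pos hP, h2]
    exact congr_arg (fun r => E r (h * k)) h1
  have f3 : ∀ h x, x ∉ F → ¬ P x → f h x = x := fun h x hx hP => by
    simp only [f, if_neg hx, dif_neg hP]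
  let _ : MulAction H X :=
    { smul := f
      one_smul := fun x => by
        change f 1 x = x
        by_cases hx : x ∈ F
        · simp [f1 _ _ hx]
        · by_cases hP : P x
          · obtain ⟨⟨r, k⟩, hr, rfl⟩ := hP
            simp [f2 _ hr]
          · exact f3 _ _ hx hP
      mul_smul := fun h k x => by
        change f (h * k) x = f h (f k x)
        by_cases hx : x ∈ F
        · rw [f1 _ _ hx, f1 _ _ hx, f1 _ _ (hF _ _ hx), map_mul]
          rfl
        · by_cases hP : P x
          · obtain ⟨⟨r, l⟩, hr, rfl⟩ := hP
            simp only [f2 _ hr, mul_assoc]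
          · rw [f3 _ _ hx hP, f3 _ _ hx hP, f3 _ _ hx hP] }
  exact ⟨MulAction.toPermHom H X, f1, f2⟩

/-- The element of the free product spelled by a list of pairs, the head being applied last. -/
def wordProd (l : List (G × H)) : Monoid.Coprod G H :=
  (l.map fun a => Monoid.Coprod.inl a.1 * Monoid.Coprod.inr a.2).prod

/-- The permutation of `X` given by a list of pairs, the head being applied last. -/
def evalWord (σ : H →* Equiv.Perm X) (l : List (G × H)) (x : X) : X :=
  freeProductHom G σ (wordProd l) x

@[simp] theorem evalWord_nil (σ : H →* Equiv.Perm X) (x : X) :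
    evalWord σ ([] : List (G × H)) x = x := by
  simp [evalWord, wordProd]

@[simp] theorem evalWord_cons (σ : H →* Equiv.Perm X) (a : G × H) (l : List (G × H)) (x : X) :
    evalWord σ (a :: l) x = a.1 • σ a.2 (evalWord σ l x) := by
  simp [evalWord, wordProd, map_mul]

theorem evalWord_append (σ : H →* Equiv.Perm X) (l l' : List (G × H)) (x : X) :
    evalWord σ (l ++ l') x = evalWord σ l (evalWord σ l' x) := by
  simp [evalWord, wordProd, map_mul]

theorem evalWord_injective (σ : H →* Equiv.Perm X) (l : List (G × H)) :
    Function.Injective (evalWord σ l) :=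
  (freeProductHom G σ (wordProd l)).injective

/-- All letters of the word are nontrivial on both sides. -/
def IsReducedWord (l : List (G × H)) : Prop := ∀ a ∈ l, a.1 ≠ 1 ∧ a.2 ≠ 1

theorem IsReducedWord.append {l m : List (G × H)} (hl : IsReducedWord l)
    (hm : IsReducedWord m) : IsReducedWord (l ++ m) := fun a ha =>
  (List.mem_append.1 ha).elim (hl a) (hm a)

/-- If `τ` agrees with an admissible action on a finite set, then every point is moved out of this
set by some reduced word. -/
theorem exists_isReducedWord_notMem [Nontrivial G] (hH : ∀ a b : H, ∃ c, c ≠ a ∧ c ≠ b)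
    {σ τ : H →* Equiv.Perm X} (hσ : IsAdmissible G σ) {F : Set X} (hF : F.Finite)
    (hτ : ∀ h, ∀ x ∈ F, τ h x = σ h x) (p : X) :
    ∃ l : List (G × H), IsReducedWord l ∧ evalWord τ l p ∉ F := by
  by_contra! hcon
  let S : Set X := {x | ∃ l : List (G × H), IsReducedWord l ∧ evalWord τ l p = x}
  have hSF : S ⊆ F := by
    rintro _ ⟨l, hl, rfl⟩
    exact hcon l hl
  have hSfin : S.Finite := hF.subset hSF
  have hstep : ∀ (g : G) (h : H), g ≠ 1 → h ≠ 1 → ∀ x ∈ S, g • τ h x ∈ S := by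
    rintro g h hg hh _ ⟨l, hl, rfl⟩
    refine ⟨(g, h) :: l, ?_, by simp⟩
    rintro a (_ | ⟨_, ha⟩)
    exacts [⟨hg, hh⟩, hl a ha]
  -- An injective self-map of the finite set `S` is onto.
  have hsurj : ∀ (g : G) (h : H), g ≠ 1 → h ≠ 1 → ∀ x ∈ S, ∃ y ∈ S, g • τ h y = x := by
    intro g h hg hh x hx
    have hinj : Function.Injective fun y => g • τ h y :=
      (MulAction.injective g).comp (τ h).injective
    have hsub : (fun y => g • τ h y) '' S ⊆ S := Set.image_subset_iff.2 (hstep g h hg hh)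
    have heq := Set.eq_of_subset_of_ncard_le hsub (Set.ncard_image_of_injective S hinj).ge hSfin
    rw [← heq] at hx
    exact hx
  obtain ⟨g₀, hg₀⟩ := exists_ne (1 : G)
  have hSH : ∀ h, ∀ x ∈ S, τ h x ∈ S := by
    intro k x hx
    -- Here `|H| ≥ 3` enters: both `h` and `h * k` are nontrivial, and cancelling `g₀ • τ h` from
    -- `g₀ • τ (h * k) x` leaves `τ k x` in `S`.
    obtain ⟨h, h1, hk⟩ := hH 1 k⁻¹
    have hhk : h * k ≠ 1 := fun h' => hk (eq_inv_of_mul_eq_one_left h')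
    obtain ⟨y, hy, hyx⟩ := hsurj g₀ h hg₀ h1 _ (hstep g₀ (h * k) hg₀ hhk x hx)
    have h3 : τ h y = τ h (τ k x) := by
      simpa [map_mul] using MulAction.injective g₀ hyx
    rwa [← (τ h).injective h3]
  have hSG : ∀ (g : G), ∀ x ∈ S, g • x ∈ S := by
    intro g x hx
    by_cases hg : g = 1
    · simpa [hg] using hx
    obtain ⟨h, h1, -⟩ := hH 1 1
    have := hstep g h hg h1 _ (hSH h⁻¹ x hx)
    simpa using this
  have hp : p ∈ S := ⟨[], by simp [IsReducedWord], by simp⟩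
  refine hσ p (hSfin.subset (orbit_jointGroup_subset hSG (fun h x hx => ?_) hp))
  rw [← hτ h x (hSF hx)]
  exact hSH h x hx

/-- On an orbit inside `F` the two actions agree, so it would contain an infinite `σ`-orbit. -/
theorem orbit_not_subset_of_agree {σ τ : H →* Equiv.Perm X} (hσ : IsAdmissible G σ) {F : Set X}
    (hF : F.Finite) (hτ : ∀ h, ∀ x ∈ F, τ h x = σ h x) (x : X) :
    ¬ MulAction.orbit (jointGroup G τ) x ⊆ F := by
  intro hsub
  refine hσ x ((hF.subset hsub).subset (orbit_jointGroup_subset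
    (fun g y hy => smul_mem_orbit_jointGroup g hy) (fun h y hy => ?_)
    (MulAction.mem_orbit_self x)))
  rw [← hτ h y (hsub hy)]
  exact apply_mem_orbit_jointGroup h hy

theorem infinite_orbit_of_mem {τ : H →* Equiv.Perm X} {x y : X}
    (hy : y ∈ MulAction.orbit (jointGroup G τ) x)
    (h : (MulAction.orbit (jointGroup G τ) y).Infinite) :
    (MulAction.orbit (jointGroup G τ) x).Infinite := by
  rwa [← MulAction.orbit_eq_iff.2 hy]

end Tree

/-! ### Trees attached to a finite invariant set -/

section TreeData

/-- Data used to attach trees to a finite part `F` of the free `G`-set `X`: the orbits are numbered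
by `idx`, the `n`-th one has base point `base n`, those that meet `F` have numbers at most `bound`,
and `next r h` is the number of the fresh orbit to which the point `r` is sent by `h`. -/
structure TreeData (G H X : Type*) [Group G] [Group H] [MulAction G X] where
  idx : X → ℕ
  base : ℕ → X
  F : Set X
  bound : ℕ
  next : X → H → ℕ
  idx_smul : ∀ (g : G) (x : X), idx (g • x) = idx x
  idx_base : ∀ n, idx (base n) = n
  eq_one_of_smul_eq : ∀ (g : G) (x : X), g • x = x → g = 1
  idx_le : ∀ x ∈ F, idx x ≤ bound
  next_inj : ∀ r s h k, next r h = next s k → r = s ∧ h = k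
  bound_lt_next : ∀ r h, bound < next r h
  idx_lt_next : ∀ r h, idx r < next r h

variable {G H X : Type*} [Group G] [Group H] [MulAction G X]

theorem exists_treeData [Countable G] [Countable H]
    (e : X ≃ (_ : ℕ) × G) (he : ∀ (g : G) (x : X), e (g • x) = ⟨(e x).1, g * (e x).2⟩)
    {F : Set X} (hF : F.Finite) : ∃ D : TreeData G H X, D.F = F := by
  have : Countable X := e.injective.countable
  obtain ⟨c, hc⟩ := exists_injective_nat (X × H)
  obtain ⟨M, hM⟩ := (hF.image fun x => (e x).1).bddAbove
  refine ⟨{ idx := fun x => (e x).1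
            base := fun n => e.symm ⟨n, 1⟩
            F := F
            bound := M
            -- Pairing with an injective code of `(r, h)` gives injectivity and dominates the index;
            -- the shift by `M + 1` exceeds the bound and makes both inequalities strict.
            next := fun r h => Nat.pair (e r).1 (c (r, h)) + M + 1
            idx_smul := fun g x => by simp [he]
            idx_base := fun n => by simp
            eq_one_of_smul_eq := fun g x h => ?_
            idx_le := fun x hx => hM ⟨x, hx, rfl⟩
            next_inj := fun r s h k hn => ?_
            bound_lt_next := fun r h => by omega
            idx_lt_next := fun r h => ?_ }, rfl⟩
  · have h1 := he g x
    rw [h] at h1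
    have h2 : (e x).2 = g * (e x).2 := by
      conv_lhs => rw [h1]
    simpa using h2
  · have h1 : Nat.pair (e r).1 (c (r, h)) = Nat.pair (e s).1 (c (s, k)) := by omega
    have h2 := hc (Nat.pair_eq_pair.1 h1).2
    exact Prod.mk.inj h2
  · have := Nat.left_le_pair (e r).1 (c (r, h))
    omega

namespace TreeData

variable (D : TreeData G H X)

/-- The points outside `F` which are not base points of fresh orbits. -/
def roots : Set X := {x | x ∉ D.F ∧ (D.idx x ≤ D.bound ∨ x ≠ D.base (D.idx x))}

theorem smul_base_mem_roots {g : G} (hg : g ≠ 1) {n : ℕ} (hn : D.bound < n) :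
    g • D.base n ∈ D.roots := by
  have hi : D.idx (g • D.base n) = n := by rw [D.idx_smul, D.idx_base]
  refine ⟨fun h => ?_, Or.inr fun h => ?_⟩
  · have := D.idx_le _ h
    omega
  · rw [hi] at h
    exact hg (D.eq_one_of_smul_eq _ _ h)

theorem base_notMem_roots {n : ℕ} (hn : D.bound < n) : D.base n ∉ D.roots := by
  rintro ⟨-, h | h⟩
  · rw [D.idx_base] at h
    omega
  · rw [D.idx_base] at h
    exact h rfl

theorem base_notMem_F {n : ℕ} (hn : D.bound < n) : D.base n ∉ D.F := fun h => by
  have := D.idx_le _ h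
  rw [D.idx_base] at this
  omega

theorem mem_roots_or {x : X} (hx : x ∉ D.F) :
    x ∈ D.roots ∨ D.bound < D.idx x ∧ x = D.base (D.idx x) := by
  by_cases h : D.bound < D.idx x ∧ x = D.base (D.idx x)
  · exact Or.inr h
  · exact Or.inl ⟨hx, by
      rw [not_and_or, not_lt] at h
      exact h⟩

theorem smul_mem_of_mem_F {x : X} (hx : x ∈ D.F) (g : G) : g • x ∈ D.F ∪ D.roots := by
  by_cases h : g • x ∈ D.F
  · exact Or.inl h
  · exact Or.inr ⟨h, Or.inl (by rw [D.idx_smul]; exact D.idx_le x hx)⟩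

/-- Roots in the fresh orbits remember the element of `H` leading to their orbit. -/
theorem smul_base_next_inj {g : G} {r s : X} {h k : H}
    (hrs : g • D.base (D.next r h) = g • D.base (D.next s k)) : h = k := by
  have h1 := congr_arg D.idx (MulAction.injective g hrs)
  rw [D.idx_base, D.idx_base] at h1
  exact (D.next_inj _ _ _ _ h1).2

/-- The action attached to the tree data, in which moreover `k` sends each `z ∈ Z` to `ℓ z`. -/
theorem exists_linked (σ : H →* Equiv.Perm X) (hF : ∀ h, ∀ x ∈ D.F, σ h x ∈ D.F)
    {k : H} (hk : k ≠ 1) {Z : Set X} {ℓ : X → X} (hℓ : ∀ z ∈ Z, ℓ z ∈ D.roots)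
    (hinj : Set.InjOn ℓ Z) :
    ∃ τ : H →* Equiv.Perm X, (∀ h, ∀ x ∈ D.F, τ h x = σ h x) ∧
      (∀ r ∈ D.roots, r ∉ ℓ '' Z → ∀ h, h ≠ 1 → (h = k → r ∉ Z) →
        τ h r = D.base (D.next r h)) ∧
      ∀ z ∈ Z, z ∈ D.roots → z ∉ ℓ '' Z → τ k z = ℓ z := by
  classical
  let E : X → H → X := fun r h =>
    if h = 1 then r else if h = k ∧ r ∈ Z then ℓ r else D.base (D.next r h)
  have hE1 : ∀ r, E r 1 = r := fun r => if_pos rfl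
  have hcases : ∀ r h, (h = 1 ∧ E r h = r) ∨ (h = k ∧ r ∈ Z ∧ E r h = ℓ r) ∨
      (E r h = D.base (D.next r h)) := by
    intro r h
    by_cases h1 : h = 1
    · exact Or.inl ⟨h1, if_pos h1⟩
    by_cases h2 : h = k ∧ r ∈ Z
    · exact Or.inr (Or.inl ⟨h2.1, h2.2, by simp only [E, if_neg h1, if_pos h2]⟩)
    · exact Or.inr (Or.inr (by simp only [E, if_neg h1, if_neg h2]))
  -- Link targets no longer start their own `H`-orbit: each occupies slot `k` in the orbit of the
  -- point linked to it.
  obtain ⟨τ, hτF, hτ⟩ := exists_extension σ hF (R := D.roots \ ℓ '' Z) (E := E)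
    (by
      intro r hr s hs h h' hrs
      have hbr := fun (x : X) (h : H) => D.base_notMem_roots (D.bound_lt_next x h)
      rcases hcases r h with ⟨a, b⟩ | ⟨a, b, c⟩ | a <;>
        rcases hcases s h' with ⟨a', b'⟩ | ⟨a', b', c'⟩ | a'
      · exact ⟨by rw [← b, hrs, b'], by rw [a, a']⟩
      · exact absurd ⟨s, b', by rw [← c', ← hrs, b]⟩ hr.2
      · exact absurd (by rw [← a', ← hrs, b]; exact hr.1) (hbr s h')
      · exact absurd ⟨r, b, by rw [← c, hrs, b']⟩ hs.2
      · exact ⟨hinj b b' (by rw [← c, hrs, c']), by rw [a, a']⟩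
      · exact absurd (by rw [← a', ← hrs, c]; exact hℓ r b) (hbr s h')
      · exact absurd (by rw [← a, hrs, b']; exact hs.1) (hbr r h)
      · exact absurd (by rw [← a, hrs, c']; exact hℓ s b') (hbr r h)
      · have := congr_arg D.idx (a.symm.trans (hrs.trans a'))
        rw [D.idx_base, D.idx_base] at this
        exact D.next_inj _ _ _ _ this)
    (by
      intro r hr h
      rcases hcases r h with ⟨a, b⟩ | ⟨a, b, c⟩ | a
      · rw [b]
        exact hr.1.1
      · rw [c]
        exact (hℓ r b).1
      · rw [a]
        exact D.base_notMem_F (D.bound_lt_next r h))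
  have hτ1 : ∀ r ∈ D.roots, r ∉ ℓ '' Z → ∀ h, τ h r = E r h := fun r hr hr' h => by
    have := hτ r ⟨hr, hr'⟩ h 1
    rwa [hE1, mul_one] at this
  refine ⟨τ, hτF, fun r hr hr' h h1 hhk => ?_, fun z hz hz' hz'' => ?_⟩
  · rw [hτ1 r hr hr' h]
    have : ¬ (h = k ∧ r ∈ Z) := fun h' => hhk h'.1 h'.2
    simp only [E, if_neg h1, if_neg this]
  · rw [hτ1 z hz' hz'' k]
    simp only [E, if_neg hk, if_pos (⟨trivial, hz⟩ : True ∧ z ∈ Z)]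

theorem exists_unlinked [Nontrivial H] (σ : H →* Equiv.Perm X)
    (hF : ∀ h, ∀ x ∈ D.F, σ h x ∈ D.F) :
    ∃ τ : H →* Equiv.Perm X, (∀ h, ∀ x ∈ D.F, τ h x = σ h x) ∧
      ∀ r ∈ D.roots, ∀ h, h ≠ 1 → τ h r = D.base (D.next r h) := by
  obtain ⟨k, hk⟩ := exists_ne (1 : H)
  obtain ⟨τ, h1, h2, -⟩ := D.exists_linked σ hF hk (Z := ∅) (ℓ := id) (by simp) (by simp)
  exact ⟨τ, h1, fun r hr h hh => h2 r hr (by simp) h hh (by simp)⟩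

section Unlinked

variable {D} {τ : H →* Equiv.Perm X}

/-- A nontrivial `h` sends a root to the base of a later orbit, and a nontrivial `g` moves it off
that base, to a root again. -/
theorem evalWord_mem_roots (hτ : ∀ r ∈ D.roots, ∀ h, h ≠ 1 → τ h r = D.base (D.next r h))
    {l : List (G × H)} (hl : IsReducedWord l) {x : X} (hx : x ∈ D.roots) :
    evalWord τ l x ∈ D.roots ∧ D.idx x + l.length ≤ D.idx (evalWord τ l x) := by
  induction l with
  | nil => simpa using hx
  | cons a l ih =>
    obtain ⟨h1, h2⟩ := ih fun b hb => hl b (List.mem_cons_of_mem _ hb)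
    obtain ⟨ha, ha'⟩ := hl a List.mem_cons_self
    rw [evalWord_cons, hτ _ h1 _ ha']
    refine ⟨D.smul_base_mem_roots ha (D.bound_lt_next _ _), ?_⟩
    rw [D.idx_smul, D.idx_base]
    have := D.idx_lt_next (evalWord τ l x) a.2
    simp only [List.length_cons]
    omega

theorem evalWord_mem (hF : ∀ h, ∀ x ∈ D.F, τ h x ∈ D.F)
    (hτ : ∀ r ∈ D.roots, ∀ h, h ≠ 1 → τ h r = D.base (D.next r h))
    {l : List (G × H)} (hl : IsReducedWord l) {x : X} (hx : x ∈ D.F ∪ D.roots) :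
    evalWord τ l x ∈ D.F ∪ D.roots := by
  induction l with
  | nil => simpa using hx
  | cons a l ih =>
    obtain ⟨ha, ha'⟩ := hl a List.mem_cons_self
    rw [evalWord_cons]
    rcases ih fun b hb => hl b (List.mem_cons_of_mem _ hb) with h | h
    · exact D.smul_mem_of_mem_F (hF _ _ h) _
    · rw [hτ _ h _ ha']
      exact Or.inr (D.smul_base_mem_roots ha (D.bound_lt_next _ _))

/-- Some word moves a given finite part of `F` to roots simultaneously. -/
theorem exists_evalWord_mem_roots [Nontrivial G] (hH : ∀ a b : H, ∃ c, c ≠ a ∧ c ≠ b)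
    {σ : H →* Equiv.Perm X} (hσ : IsAdmissible G σ) (hfin : D.F.Finite)
    (hF : ∀ h, ∀ x ∈ D.F, σ h x ∈ D.F) (hτF : ∀ h, ∀ x ∈ D.F, τ h x = σ h x)
    (hτ : ∀ r ∈ D.roots, ∀ h, h ≠ 1 → τ h r = D.base (D.next r h))
    {A : Set X} (hA : A.Finite) (hAF : A ⊆ D.F) :
    ∃ l : List (G × H), IsReducedWord l ∧ ∀ x ∈ A, evalWord τ l x ∈ D.roots := by
  have hF' : ∀ h, ∀ x ∈ D.F, τ h x ∈ D.F := fun h x hx => by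
    rw [hτF h x hx]
    exact hF h x hx
  induction A, hA using Set.Finite.induction_on with
  | empty => exact ⟨[], by simp [IsReducedWord], by simp⟩
  | @insert x A _ _ ih =>
    obtain ⟨l, hl, hlA⟩ := ih ((Set.subset_insert x A).trans hAF)
    -- Points already moved to roots stay roots under any further reduced word, so only the new
    -- point matters.
    obtain ⟨l', hl', hlF⟩ := exists_isReducedWord_notMem hH hσ hfin hτF (evalWord τ l x)
    refine ⟨l' ++ l, IsReducedWord.append hl' hl, ?_⟩
    rintro y (rfl | hy)
    · rw [← evalWord_append] at hlF
      exact (evalWord_mem hF' hτ (IsReducedWord.append hl' hl)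
        (Or.inl (hAF (Set.mem_insert y A)))).resolve_left hlF
    · rw [evalWord_append]
      exact (evalWord_mem_roots hτ hl' (hlA y hy)).1

end Unlinked

end TreeData

end TreeData

/-! ### Density for transitivity: linking far roots -/

section Linking

variable {G H X : Type*} [Group G] [Group H] [MulAction G X]

/-- A tree action is admissible even after linking, if some branch avoids the links. -/
theorem TreeData.isAdmissible_of_linked [Nontrivial G] (D : TreeData G H X)
    {σ τ : H →* Equiv.Perm X} (hσ : IsAdmissible G σ) (hfin : D.F.Finite)
    (hτF : ∀ h, ∀ x ∈ D.F, τ h x = σ h x) {W : Set X} {g : G} (hg : g ≠ 1) {h : H}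
    (hτ : ∀ r ∈ D.roots, r ∉ W → τ h r = D.base (D.next r h))
    (hW : ∀ r, g • D.base (D.next r h) ∉ W)
    (hW' : ∀ v ∈ W, ∃ k, τ k v ∈ D.roots ∧ τ k v ∉ W) : IsAdmissible G τ := by
  have hroot : ∀ r ∈ D.roots, r ∉ W → (MulAction.orbit (jointGroup G τ) r).Infinite := by
    intro r hr hrW
    -- The letter `(g, h)` can be repeated forever: it leads from a root outside `W` to another one
    -- of larger index.
    have key : ∀ n : ℕ, ∃ y ∈ MulAction.orbit (jointGroup G τ) r,
        y ∈ D.roots ∧ y ∉ W ∧ n ≤ D.idx y := by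
      intro n
      induction n with
      | zero => exact ⟨r, MulAction.mem_orbit_self r, hr, hrW, Nat.zero_le _⟩
      | succ n ih =>
        obtain ⟨y, hy, hyr, hyW, hn⟩ := ih
        have := smul_mem_orbit_jointGroup g (apply_mem_orbit_jointGroup h hy)
        rw [hτ y hyr hyW] at this
        refine ⟨_, this, D.smul_base_mem_roots hg (D.bound_lt_next _ _), hW y, ?_⟩
        rw [D.idx_smul, D.idx_base]
        have := D.idx_lt_next y h
        omega
    intro hfin
    obtain ⟨M, hM⟩ := (hfin.image D.idx).bddAbove
    obtain ⟨y, hy, -, -, hn⟩ := key (M + 1)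
    have := hM ⟨y, hy, rfl⟩
    omega
  have hroot' : ∀ r ∈ D.roots, (MulAction.orbit (jointGroup G τ) r).Infinite := by
    intro r hr
    by_cases hrW : r ∈ W
    · obtain ⟨k, hk, hkW⟩ := hW' r hrW
      exact infinite_orbit_of_mem (apply_mem_orbit_jointGroup k (MulAction.mem_orbit_self r))
        (hroot _ hk hkW)
    · exact hroot r hr hrW
  have hout : ∀ x, x ∉ D.F → (MulAction.orbit (jointGroup G τ) x).Infinite := by
    intro x hx
    rcases D.mem_roots_or hx with hr | ⟨hb, hx'⟩
    · exact hroot' x hr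
    · refine infinite_orbit_of_mem (smul_mem_orbit_jointGroup g (MulAction.mem_orbit_self x)) ?_
      rw [hx']
      exact hroot' _ (D.smul_base_mem_roots hg hb)
  intro x
  obtain ⟨y, hy, hyF⟩ := Set.not_subset.1 (orbit_not_subset_of_agree hσ hfin hτF x)
  exact infinite_orbit_of_mem hy (hout y hyF)

/-- Used to place the links beyond every point visited while reading `l`. -/
theorem exists_idx_evalWord_le (D : TreeData G H X) (τ : H →* Equiv.Perm X) (l : List (G × H))
    {A : Set X} (hA : A.Finite) :
    ∃ K, ∀ x ∈ A, ∀ l', l' <:+ l → D.idx (evalWord τ l' x) ≤ K := by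
  have hl : {l' | l' <:+ l}.Finite :=
    (List.finite_toSet l.tails).subset fun l' hl' => (List.mem_tails l' l).2 hl'
  obtain ⟨K, hK⟩ := ((hl.prod hA).image fun p => D.idx (evalWord τ p.1 p.2)).bddAbove
  exact ⟨K, fun x hx l' hl' => hK ⟨(l', x), ⟨hl', hx⟩, rfl⟩⟩

theorem exists_admissible_agree_map_tuple [Countable G] [Countable H] [Nontrivial G] [Finite H]
    (hH : ∀ a b : H, ∃ c, c ≠ a ∧ c ≠ b)
    (e : X ≃ (_ : ℕ) × G) (he : ∀ (g : G) (x : X), e (g • x) = ⟨(e x).1, g * (e x).2⟩)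
    {σ : H →* Equiv.Perm X} (hσ : IsAdmissible G σ) {F : Set X} (hF : F.Finite)
    (hFσ : ∀ h, ∀ x ∈ F, σ h x ∈ F) {k : ℕ} {x y : Fin k ↪ X} (hxy : ∀ i j, x i ≠ y j)
    (hxF : ∀ i, x i ∈ F) (hyF : ∀ i, y i ∈ F) :
    ∃ τ : H →* Equiv.Perm X, IsAdmissible G τ ∧ (∀ h, ∀ x ∈ F, τ h x = σ h x) ∧
      ∃ w : Monoid.Coprod G H, ∀ i, freeProductHom G τ w (x i) = y i := by
  obtain ⟨D, rfl⟩ := exists_treeData (G := G) (H := H) e he hF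
  obtain ⟨g, hg⟩ := exists_ne (1 : G)
  obtain ⟨a, ha, -⟩ := hH 1 1
  -- `b` is reserved for the links; `a` serves for padding words and for the branch escaping to
  -- infinity.
  obtain ⟨b, hb, hba⟩ := hH 1 a
  have : Nontrivial H := ⟨a, 1, ha⟩
  obtain ⟨τ₁, hτ₁F, hτ₁⟩ := D.exists_unlinked σ hFσ
  have hF₁ : ∀ h, ∀ x ∈ D.F, τ₁ h x ∈ D.F := fun h x hx => by
    rw [hτ₁F h x hx]
    exact hFσ h x hx
  have hAF : Set.range x ∪ Set.range y ⊆ D.F := by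
    rintro _ (⟨i, rfl⟩ | ⟨i, rfl⟩)
    exacts [hxF i, hyF i]
  have hA : (Set.range x ∪ Set.range y).Finite := (Set.finite_range x).union (Set.finite_range y)
  obtain ⟨l, hl, hlA⟩ := TreeData.exists_evalWord_mem_roots hH hσ hF hFσ hτ₁F hτ₁ hA hAF
  obtain ⟨K, hK⟩ := exists_idx_evalWord_le D τ₁ l hA
  have hrep : ∀ m, IsReducedWord (List.replicate m (g, a)) := fun m p hp => by
    rw [List.eq_of_mem_replicate hp]
    exact ⟨hg, ha⟩
  -- the word that moves all the points to roots of large index, all reached by the letter `b`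
  let u : X → X := evalWord τ₁ (List.replicate K (g, a) ++ l)
  let z : X → X := evalWord τ₁ ((g, b) :: (List.replicate K (g, a) ++ l))
  have hu : ∀ p ∈ Set.range x ∪ Set.range y, u p ∈ D.roots ∧ K ≤ D.idx (u p) := fun p hp => by
    have := TreeData.evalWord_mem_roots hτ₁ (hrep K) (hlA p hp)
    simp only [u, evalWord_append]
    rw [List.length_replicate] at this
    exact ⟨this.1, by omega⟩
  have hz : ∀ p ∈ Set.range x ∪ Set.range y, z p = g • D.base (D.next (u p) b) := fun p hp => by
    simp only [z, evalWord_cons]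
    exact congr_arg _ (hτ₁ _ (hu p hp).1 _ hb)
  have hzroots : ∀ p ∈ Set.range x ∪ Set.range y, z p ∈ D.roots := fun p hp => by
    rw [hz p hp]
    exact D.smul_base_mem_roots hg (D.bound_lt_next _ _)
  have hzidx : ∀ p ∈ Set.range x ∪ Set.range y, K < D.idx (z p) := fun p hp => by
    rw [hz p hp, D.idx_smul, D.idx_base]
    exact (hu p hp).2.trans_lt (D.idx_lt_next _ _)
  have hztag : ∀ r, ∀ p ∈ Set.range x ∪ Set.range y, g • D.base (D.next r a) ≠ z p :=
    fun r p hp h => by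
      rw [hz p hp] at h
      exact hba (D.smul_base_next_inj h).symm
  have hzinj : Function.Injective z := evalWord_injective _ _
  have hx : ∀ i, x i ∈ Set.range x ∪ Set.range y := fun i => Or.inl ⟨i, rfl⟩
  have hy : ∀ i, y i ∈ Set.range x ∪ Set.range y := fun i => Or.inr ⟨i, rfl⟩
  have hzx : Function.Injective fun i => z (x i) := hzinj.comp x.injective
  let ℓ : X → X := Function.extend (fun i => z (x i)) (fun i => z (y i)) id
  have hℓ : ∀ i, ℓ (z (x i)) = z (y i) := fun i => hzx.extend_apply _ _ i
  let Z : Set X := Set.range fun i => z (x i)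
  have hW : ∀ v, v ∈ ℓ '' Z ↔ ∃ i, z (y i) = v := by
    intro v
    constructor
    · rintro ⟨_, ⟨i, rfl⟩, rfl⟩
      exact ⟨i, (hℓ i).symm⟩
    · rintro ⟨i, rfl⟩
      exact ⟨_, ⟨i, rfl⟩, hℓ i⟩
  have hZW : ∀ i, z (x i) ∉ ℓ '' Z := fun i h => by
    obtain ⟨j, hj⟩ := (hW _).1 h
    exact hxy i j (hzinj hj).symm
  obtain ⟨τ, hτF, hτ, hτZ⟩ := D.exists_linked σ hFσ hb (Z := Z) (ℓ := ℓ)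
    (by
      rintro _ ⟨i, rfl⟩
      simp only [hℓ]
      exact hzroots _ (hy i))
    (by
      rintro _ ⟨i, rfl⟩ _ ⟨j, rfl⟩ hij
      simp only [hℓ] at hij
      rw [y.injective (hzinj hij)])
  have hlink : ∀ i, τ b (z (x i)) = z (y i) := fun i => by
    rw [hτZ _ ⟨i, rfl⟩ (hzroots _ (hx i)) (hZW i), hℓ]
  -- the two actions agree along the word
  have hagree : ∀ v ∈ D.F ∪ D.roots, (∀ p ∈ Set.range x ∪ Set.range y, v ≠ z p) →
      ∀ h, h ≠ 1 → τ h v = τ₁ h v := by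
    rintro v (hv | hv) hvz h hh
    · rw [hτF h v hv, hτ₁F h v hv]
    · rw [hτ₁ v hv h hh, hτ v hv _ h hh]
      · rintro - ⟨i, rfl⟩
        exact hvz _ (hx i) rfl
      · intro h'
        obtain ⟨i, rfl⟩ := (hW v).1 h'
        exact hvz _ (hy i) rfl
  have hword : ∀ p ∈ Set.range x ∪ Set.range y,
      evalWord τ ((g, b) :: (List.replicate K (g, a) ++ l)) p = z p := by
    intro p hp
    -- Within `l` all visited indices are at most `K`, while linked points have larger index.
    have h1 : ∀ l', l' <:+ l → evalWord τ l' p = evalWord τ₁ l' p := by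
      intro l'
      induction l' with
      | nil => simp
      | cons c l' ih =>
        intro hc
        have hl' : l' <:+ l := (List.suffix_cons c l').trans hc
        have hred : IsReducedWord l' := fun d hd => hl d (hl'.subset hd)
        rw [evalWord_cons, evalWord_cons, ih hl', hagree _
          (TreeData.evalWord_mem hF₁ hτ₁ hred (Or.inl (hAF hp))) (fun q hq h => ?_) _
          (hl c (hc.subset List.mem_cons_self)).2]
        have := hzidx q hq
        have := hK p hp l' hl'
        rw [h] at this
        omega
    -- Within the padding, points are reached by the letter `a`, linked points by `b`, so they
    -- differ whatever their index.
    have h2 : ∀ m, evalWord τ (List.replicate m (g, a) ++ l) p =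
          evalWord τ₁ (List.replicate m (g, a) ++ l) p ∧
        ∀ q ∈ Set.range x ∪ Set.range y, evalWord τ₁ (List.replicate m (g, a) ++ l) p ≠ z q := by
      intro m
      have hroots : ∀ m, evalWord τ₁ (List.replicate m (g, a) ++ l) p ∈ D.roots := fun m => by
        rw [evalWord_append]
        exact (TreeData.evalWord_mem_roots hτ₁ (hrep m) (hlA p hp)).1
      induction m with
      | zero =>
        refine ⟨h1 l List.suffix_rfl, fun q hq h => ?_⟩
        have h3 := hzidx q hq
        have h4 := hK p hp l List.suffix_rfl
        rw [← h] at h3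
        exact absurd h4 (not_le.2 h3)
      | succ m ih =>
        simp only [List.replicate_succ, List.cons_append, evalWord_cons]
        rw [ih.1, hagree _ (Or.inr (hroots m)) ih.2 _ ha, hτ₁ _ (hroots m) _ ha]
        exact ⟨rfl, fun q hq => hztag _ q hq⟩
    simp only [z, evalWord_cons]
    rw [(h2 K).1, hagree _ (Or.inr (hu p hp).1) (h2 K).2 _ hb]
  refine ⟨τ, ?_, hτF, (wordProd ((g, b) :: (List.replicate K (g, a) ++ l)))⁻¹ *
    (Monoid.Coprod.inr b * wordProd ((g, b) :: (List.replicate K (g, a) ++ l))), fun i => ?_⟩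
  · refine D.isAdmissible_of_linked hσ hF hτF hg (h := a) (W := ℓ '' Z)
      (fun r hr hrW => hτ r hr hrW a ha fun h => absurd h.symm hba) (fun r h => ?_) fun v hv => ?_
    · obtain ⟨i, hi⟩ := (hW _).1 h
      exact hztag r _ (hy i) hi.symm
    · obtain ⟨i, rfl⟩ := (hW v).1 hv
      -- A link target goes back to its source, a root that is not itself a target.
      refine ⟨b⁻¹, ?_⟩
      rw [← hlink i, ← Equiv.Perm.mul_apply, ← map_mul, inv_mul_cancel, map_one,
        Equiv.Perm.one_apply]
      exact ⟨hzroots _ (hx i), hZW i⟩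
  · rw [map_mul, map_mul, map_inv]
    simp only [Equiv.Perm.mul_apply]
    rw [Equiv.Perm.inv_eq_iff_eq, freeProductHom_inr]
    exact (congr_arg (τ b) (hword _ (hx i))).trans ((hlink i).trans (hword _ (hy i)).symm)

end Linking

/-! ### Open dense sets of actions -/

section Generic

variable {G H X : Type*} [Group G] [Group H] [MulAction G X]

theorem exists_embedding_fin_avoiding [Infinite X] (k : ℕ) {A : Set X} (hA : A.Finite) :
    ∃ u : Fin k ↪ X, ∀ i, u i ∉ A := by
  have : Infinite (Aᶜ : Set X) := hA.infinite_compl.to_subtype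
  let f : Fin k ↪ (Aᶜ : Set X) := Fin.valEmbedding.trans (Infinite.natEmbedding _)
  exact ⟨f.trans (Function.Embedding.subtype _), fun i => (f i).2⟩

/-- The set of admissible actions for which some element of the free product maps `x` to `y`. -/
def transporterSet (G H : Type*) {X : Type*} [Group G] [Group H] [MulAction G X] {k : ℕ}
    (x y : Fin k ↪ X) : Set (AdmissibleAction G H X) :=
  {σ | ∃ w : Monoid.Coprod G H, ∀ i, freeProductHom G σ.1 w (x i) = y i}

theorem isOpen_transporterSet {k : ℕ} (x y : Fin k ↪ X) : IsOpen (transporterSet G H x y) := by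
  have : transporterSet G H x y = ⋃ w : Monoid.Coprod G H, ⋂ i,
      {σ : AdmissibleAction G H X | freeProductHom G σ.1 w (x i) = y i} := by
    ext σ
    simp [transporterSet]
  rw [this]
  exact isOpen_iUnion fun w => isOpen_iInter_of_finite fun i =>
    AdmissibleAction.isOpen_freeProductHom_apply_eq w (x i) (y i)

theorem dense_transporterSet [Countable G] [Nontrivial G] [Finite H]
    (hH : ∀ a b : H, ∃ c, c ≠ a ∧ c ≠ b)
    (e : X ≃ (_ : ℕ) × G) (he : ∀ (g : G) (x : X), e (g • x) = ⟨(e x).1, g * (e x).2⟩)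
    {k : ℕ} (x y : Fin k ↪ X) : Dense (transporterSet G H x y) := by
  have key : ∀ x y : Fin k ↪ X, (∀ i j, x i ≠ y j) → Dense (transporterSet G H x y) := by
    intro x y hxy
    refine AdmissibleAction.dense_of_forall_agree fun σ F hF hFσ => ?_
    let A : Set X := Set.range x ∪ Set.range y
    -- `F` is enlarged by the `σ(H)`-saturation of both tuples, so that it contains them and stays
    -- invariant.
    let B : Set X := ⋃ h, σ.1 h '' A
    have hA : A.Finite := (Set.finite_range x).union (Set.finite_range y)
    have hB : B.Finite := Set.finite_iUnion fun h => hA.image _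
    have hAB : A ⊆ B := fun p hp => Set.mem_iUnion.2 ⟨1, p, hp, by simp⟩
    have hBσ : ∀ h, ∀ p ∈ B, σ.1 h p ∈ B := by
      intro h p hp
      obtain ⟨h', q, hq, rfl⟩ := Set.mem_iUnion.1 hp
      exact Set.mem_iUnion.2 ⟨h * h', q, hq, by simp [map_mul]⟩
    obtain ⟨τ, hτ, hτF, hw⟩ := exists_admissible_agree_map_tuple hH e he σ.2 (hF.union hB)
      (fun h p hp => hp.imp (hFσ h p) (hBσ h p)) hxy
      (fun i => Or.inr (hAB (Or.inl ⟨i, rfl⟩))) (fun i => Or.inr (hAB (Or.inr ⟨i, rfl⟩)))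
    exact ⟨⟨τ, hτ⟩, hw, fun h p hp => hτF h p (Or.inl hp)⟩
  have : Infinite X := Infinite.of_surjective (fun p => (e p).1) fun n => ⟨e.symm ⟨n, 1⟩, by simp⟩
  -- Overlapping tuples are joined through a third tuple disjoint from both; the intersection of the
  -- two dense open sets is dense.
  obtain ⟨u, hu⟩ := exists_embedding_fin_avoiding k
    ((Set.finite_range x).union (Set.finite_range y))
  refine ((key x u fun i j h => hu j (Or.inl ⟨i, h⟩)).inter_of_isOpen_left
    (key u y fun i j h => hu i (Or.inr ⟨j, h.symm⟩)) (isOpen_transporterSet x u)).mono ?_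
  rintro σ ⟨⟨v, hv⟩, w, hw⟩
  exact ⟨w * v, fun i => by rw [map_mul, Equiv.Perm.mul_apply, hv, hw]⟩

theorem isOpen_setOf_exists_apply_ne (w : Monoid.Coprod G H) :
    IsOpen {σ : AdmissibleAction G H X | ∃ x, freeProductHom G σ.1 w x ≠ x} := by
  have : {σ : AdmissibleAction G H X | ∃ x, freeProductHom G σ.1 w x ≠ x} =
      ⋃ (x : X) (y : X) (_ : y ≠ x), {σ | freeProductHom G σ.1 w x = y} := by
    ext σ
    simp
  rw [this]
  exact isOpen_iUnion fun x => isOpen_iUnion fun y => isOpen_iUnion fun _ =>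
    AdmissibleAction.isOpen_freeProductHom_apply_eq w x y

end Generic

end FreeProductAction

/-! ### The main theorem -/

theorem mainTheorem3 {G H X : Type*} [Group G] [Group H] [Countable G] [Nontrivial G]
    [Finite H] (hH : 3 ≤ Nat.card H) [MulAction G X]
    (e : X ≃ (_ : ℕ) × G) (he : ∀ (g : G) (x : X), e (g • x) = ⟨(e x).1, g * (e x).2⟩) :
    BaireSpace (FreeProductAction.AdmissibleAction G H X) ∧
      FreeProductAction.IsGeneric
        {σ : FreeProductAction.AdmissibleAction G H X |
          FreeProductAction.IsHighlyTransitive G σ.1 ∧ FreeProductAction.IsFaithful G σ.1} := by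
  have hX : Countable X := e.injective.countable
  have hGH : Countable (Monoid.Coprod G H) := FreeProductAction.countable_coprod
  have hH' : ∀ a b : H, ∃ c, c ≠ a ∧ c ≠ b := by
    classical
    intro a b
    have := Fintype.ofFinite H
    rw [Nat.card_eq_fintype_card] at hH
    obtain ⟨c, hc⟩ := Finset.exists_mem_notMem_of_card_lt_card (s := {a, b}) (t := Finset.univ)
      (Finset.card_le_two.trans_lt (by rw [Finset.card_univ]; omega))
    exact ⟨c, by simpa [not_or] using hc⟩
  have hemb : ∀ k, Countable (Fin k ↪ X) := fun k => DFunLike.coe_injective.countable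
  refine ⟨FreeProductAction.AdmissibleAction.baireSpace, ?_⟩
  let ι := ((k : ℕ) × ((Fin k ↪ X) × (Fin k ↪ X))) ⊕ {w : Monoid.Coprod G H // w ≠ 1}
  have hι : Nonempty ι := ⟨Sum.inl ⟨0, Function.Embedding.ofIsEmpty, Function.Embedding.ofIsEmpty⟩⟩
  obtain ⟨f, hf⟩ := exists_surjective_nat ι
  let U : ι → Set (FreeProductAction.AdmissibleAction G H X) := Sum.elim
    (fun p => FreeProductAction.transporterSet G H p.2.1 p.2.2)
    (fun w => {σ | ∃ x, FreeProductAction.freeProductHom G σ.1 w.1 x ≠ x})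
  refine ⟨fun n => U (f n), fun n => ?_, ?_⟩
  · change IsOpen (U (f n)) ∧ Dense (U (f n))
    rcases f n with ⟨k, x, y⟩ | ⟨w, hw⟩
    · exact ⟨FreeProductAction.isOpen_transporterSet x y,
        FreeProductAction.dense_transporterSet hH' e he x y⟩
    · refine ⟨FreeProductAction.isOpen_setOf_exists_apply_ne w,
        FreeProductAction.AdmissibleAction.dense_of_forall_agree fun σ F hF hFσ => ?_⟩
      obtain ⟨τ, hτ, hτF, hx⟩ :=
        FreeProductAction.exists_admissible_agree_apply_ne e he σ.2 hF hFσ hw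
      exact ⟨⟨τ, hτ⟩, hx, hτF⟩
  · rw [hf.iInter_comp]
    ext σ
    rw [Set.mem_iInter, Sum.forall]
    refine and_congr ?_ ?_
    · rw [FreeProductAction.isHighlyTransitive_iff]
      exact ⟨fun h p => h p.1 p.2.1 p.2.2, fun h k x y => h ⟨k, x, y⟩⟩
    · rw [FreeProductAction.isFaithful_iff]
      exact ⟨fun h w => h w.1 w.2, fun h w hw => h ⟨w, hw⟩⟩
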